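/- **Setting.** Fix a field $\Bbbk$. All modules are persistence modules over $\Bbbk$ indexed by $\mathbb R^2$ or by a subposet $D\subseteq\mathbb R^2$ (functors from the poset to vector spaces; $|_D$ is restriction) that is invariant under the diagonal translations $x\mapsto x+\vec\delta$, $\vec\delta=(\delta,\delta)$. Two modules $M,N$ on such a $D$ are $\delta$-interleaved ($\delta\ge0$) if there are linear maps $\phi_x:M_x\to N_{x+\vec\delta}$ and $\psi_x:N_x\to M_{x+\vec\delta}$ ($x\in D$), commuting with the structure maps of $M$ and $N$, such that $\psi_{x+\vec\delta}\phi_x=M(x\to x+2\vec\delta)$ and $\phi_{x+\vec\delta}\psi_x=N(x\to x+2\vec\delta)$ for all $x\in D$; and $d_I(M,N)\in[0,\infty]$ is the infimum of all such $\delta$ ($\infty$ if there is none). An interval is a non-empty set $I\subseteq\bar{\mathbb R}^2$, $\bar{\mathbb R}=\mathbb R\cup\{\pm\infty\}$, that is order-convex and in which any two points are joined by a finite zigzag of comparable points of $I$. The interval module on $I$ is $\Bbbk$ at the points $x\in\mathbb R^2$ that lie in $I$ and $0$ elsewhere, with identity structure maps between points of $I$ and zero maps otherwise. A rectangle module is the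 interval module of a rectangle $[\mathbf u,\mathbf v]=\{\mathbf w\in\bar{\mathbb R}^2:\mathbf u\le \mathbf w\le \mathbf v\}$, $\mathbf u\le \mathbf v$. The bounding rectangle of $I$ is the smallest rectangle containing $I$. For modules $M,N$ obtained by restricting interval modules to $D$, $d_H(M,N)$ is the Hausdorff distance, for $\|\cdot\|_\infty$, of the sets of points of $D$ where $M$ and $N$ are non-zero; if one of the two modules is zero, $d_H(M,N)$ is by convention the interleaving distance of the other one to the zero module. **Proposition.** Let $M$ be an interval module whose interval $I_M\subseteq\bar{\mathbb R}^2$ is closed, and let $R$ be a rectangle module whose interval $I_R=[\mathbf u,\mathbf v]$ is contained in the bounding rectangle of $I_M$. Let $$\Delta_R=\{x\in\mathbb R^2: u_2-v_1\le x_2-x_1\le v_2-u_1\}$$ be the closed band between the diagonal lines (of slope one) through the bottom-right corner $(v_1,u_2)$ and the top-left corner $(u_1,v_2)$ of $I_R$, where $\infty-\infty$ is read as $-\infty$ (this case only arises when $I_R$ contains no point of $\mathbb R^2$), and let $\bar\Delta_R=\mathbb R^2\setminus\Delta_R$. Then $$d_I(M,R)=\max\Big\{d_I(M|_{\bar\Delta_R},0),\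 \min\big\{\max\{d_I(M|_{\Delta_R},0),\,d_I(R|_{\Delta_R},0)\},\ d_H(M|_{\Delta_R},R|_{\Delta_R})\big\}\Big\}.$$ -/

import Mathlib

open CategoryTheory Set
open scoped NNReal ENNReal

noncomputable section

namespace PersMod

universe w

/-! ### Diagonally invariant subsets of the plane -/

/-- A subset of the plane is diagonally invariant if it is a union of lines of slope one. -/
class DiagonallyInvariant (D : Set (ℝ × ℝ)) : Prop where
  add_mem : ∀ x ∈ D, ∀ t : ℝ, (x.1 + t, x.2 + t) ∈ D

instance univ_diagonallyInvariant : DiagonallyInvariant univ where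
  add_mem _ _ _ := mem_univ _

instance compl_diagonallyInvariant (D : Set (ℝ × ℝ)) [hD : DiagonallyInvariant D] :
    DiagonallyInvariant Dᶜ where
  add_mem x hx t h := hx (by simpa using hD.add_mem _ h (-t))

section Shift

variable {D : Set (ℝ × ℝ)} [hD : DiagonallyInvariant D]

/-- The diagonal translation `x ↦ x + (δ, δ)` of `D`. -/
def shift (δ : ℝ≥0) (x : D) : D :=
  ⟨(x.1.1 + δ, x.1.2 + δ), hD.add_mem _ x.2 δ⟩

theorem shift_mono (δ : ℝ≥0) {x y : D} (h : x ≤ y) : shift δ x ≤ shift δ y :=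
  ⟨by simpa [shift] using h.1, by simpa [shift] using h.2⟩

theorem le_shift (δ : ℝ≥0) (x : D) : x ≤ shift δ x :=
  ⟨by simp [shift], by simp [shift]⟩

end Shift

/-! ### Persistence modules and the interleaving distance -/

section Modules

variable (k : Type w) [Field k]

/-- A persistence module over `k` indexed by the poset `D ⊆ ℝ²` (with the product order). The
`2`-parameter persistence modules are those with `D = univ`. -/
abbrev PersistenceModule (D : Set (ℝ × ℝ)) := D ⥤ ModuleCat.{w} k

/-- The zero module. -/
def zeroModule (D : Set (ℝ × ℝ)) : PersistenceModule k D :=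
  (Functor.const D).obj (ModuleCat.of k PUnit.{w + 1})

variable {k}

/-- `M` and `N` are `δ`-interleaved. -/
def Interleaved {D : Set (ℝ × ℝ)} [DiagonallyInvariant D] (M N : PersistenceModule k D)
    (δ : ℝ≥0) : Prop :=
  ∃ (φ : ∀ x : D, M.obj x ⟶ N.obj (shift δ x)) (ψ : ∀ x : D, N.obj x ⟶ M.obj (shift δ x)),
    (∀ x : D, φ x ≫ ψ (shift δ x) = M.map (homOfLE ((le_shift δ x).trans (le_shift δ _)))) ∧
    (∀ x : D, ψ x ≫ φ (shift δ x) = N.map (homOfLE ((le_shift δ x).trans (le_shift δ _)))) ∧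
    (∀ (x y : D) (h : x ≤ y),
      M.map (homOfLE h) ≫ φ y = φ x ≫ N.map (homOfLE (shift_mono δ h))) ∧
    (∀ (x y : D) (h : x ≤ y),
      N.map (homOfLE h) ≫ ψ y = ψ x ≫ M.map (homOfLE (shift_mono δ h)))

/-- The interleaving distance: the infimum of all `δ ≥ 0` such that `M` and `N` are
`δ`-interleaved, and `∞` if there is no such `δ`. -/
def dI {D : Set (ℝ × ℝ)} [DiagonallyInvariant D] (M N : PersistenceModule k D) : ℝ≥0∞ :=
  ⨅ (δ : ℝ≥0) (_ : Interleaved M N δ), (δ : ℝ≥0∞)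

/-- The restriction of a module on the plane to a subposet `D` of the plane. -/
def restrict (M : PersistenceModule k univ) (D : Set (ℝ × ℝ)) : PersistenceModule k D :=
  (show Monotone (fun x : D => (⟨x, mem_univ _⟩ : (univ : Set (ℝ × ℝ)))) from
    fun _ _ h => h).functor ⋙ M

/-- The set of points of the plane at which a module indexed by `D ⊆ ℝ²` is non-zero. For the
restriction to `D` of an interval module `M` with interval `I`, this is the underlying set
`I ∩ D` of `M|_D`. -/
def support {D : Set (ℝ × ℝ)} (M : PersistenceModule k D) : Set (ℝ × ℝ) :=
  {x | ∃ h : x ∈ D, Nontrivial (M.obj ⟨x, h⟩)}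

open Classical in
/-- The Hausdorff distance of two modules: the Hausdorff distance of their underlying sets, for the
norm `‖·‖_∞` (which is the norm of `ℝ × ℝ`). If one of the modules is zero, it is by convention the
interleaving distance of the other one to zero. -/
def dH {D : Set (ℝ × ℝ)} [DiagonallyInvariant D] (M N : PersistenceModule k D) : ℝ≥0∞ :=
  if support N = ∅ then dI M (zeroModule k D)
  else if support M = ∅ then dI N (zeroModule k D)
  else Metric.hausdorffEDist (support M) (support N)

end Modules

/-! ### Intervals, interval modules and rectangles -/

/-- The inclusion of the plane in the extended plane. -/
def toExt (x : ℝ × ℝ) : EReal × EReal := ((x.1 : EReal), (x.2 : EReal))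

theorem toExt_mono {x y : ℝ × ℝ} (h : x ≤ y) : toExt x ≤ toExt y :=
  ⟨EReal.coe_le_coe_iff.2 h.1, EReal.coe_le_coe_iff.2 h.2⟩

/-- Intervals of the extended plane: non-empty, order-convex and connected by finite zigzags of
comparable elements of `I`. -/
structure IsInterval (I : Set (EReal × EReal)) : Prop where
  nonempty : I.Nonempty
  convex : I.OrdConnected
  connected : ∀ p ∈ I, ∀ q ∈ I,
    Relation.ReflTransGen (fun a b => a ∈ I ∧ b ∈ I ∧ (a ≤ b ∨ b ≤ a)) p q

/-- Rectangles are intervals. -/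
theorem isInterval_Icc {u v : EReal × EReal} (h : u ≤ v) : IsInterval (Icc u v) where
  nonempty := ⟨u, le_rfl, h⟩
  convex := ordConnected_Icc
  connected _ hp _ hq :=
    (Relation.ReflTransGen.single ⟨hp, ⟨le_rfl, h⟩, Or.inr hp.1⟩).tail
      ⟨⟨le_rfl, h⟩, hq, Or.inl hq.1⟩

section IntervalModule

variable (k : Type w) [Field k]

open Classical in
/-- The space of an interval module at `x`, as a subspace of `k`: it is `k` if `x ∈ I`, and `0`
otherwise. -/
def fiber (I : Set (EReal × EReal)) (x : ℝ × ℝ) : Submodule k k :=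
  if toExt x ∈ I then ⊤ else ⊥

theorem fiber_of_mem {I : Set (EReal × EReal)} {x : ℝ × ℝ} (h : toExt x ∈ I) :
    fiber k I x = ⊤ := if_pos h

theorem fiber_of_notMem {I : Set (EReal × EReal)} {x : ℝ × ℝ} (h : toExt x ∉ I) :
    fiber k I x = ⊥ := if_neg h

open Classical in
/-- The structure map of an interval module from `x` to `y`: it is the identity if `x` and `y` lie
in `I`, and zero otherwise. -/
def fiberMap (I : Set (EReal × EReal)) (x y : ℝ × ℝ) : fiber k I x →ₗ[k] fiber k I y :=
  if h : toExt x ∈ I ∧ toExt y ∈ I then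
    Submodule.inclusion ((fiber_of_mem k h.2).symm ▸ le_top)
  else 0

theorem fiberMap_coe_of_mem {I : Set (EReal × EReal)} {x y : ℝ × ℝ}
    (hx : toExt x ∈ I) (hy : toExt y ∈ I) (c : fiber k I x) :
    (fiberMap k I x y c : k) = c := by
  rw [fiberMap, dif_pos ⟨hx, hy⟩]; rfl

theorem fiberMap_of_not {I : Set (EReal × EReal)} {x y : ℝ × ℝ}
    (h : ¬ (toExt x ∈ I ∧ toExt y ∈ I)) : fiberMap k I x y = 0 := dif_neg h

/-- The interval module on the plane with (order-convex) interval `I`. -/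
def intervalModule (I : Set (EReal × EReal)) (hI : I.OrdConnected) :
    PersistenceModule k univ where
  obj x := ModuleCat.of k (fiber k I x.1)
  map {x y} _ := ModuleCat.ofHom (fiberMap k I x.1 y.1)
  map_id x := by
    refine ModuleCat.hom_ext (LinearMap.ext fun c => Subtype.ext ?_)
    by_cases hx : toExt x.1 ∈ I
    · exact fiberMap_coe_of_mem k hx hx c
    · have hc : (c : k) = 0 :=
        (Submodule.mem_bot k).1 ((fiber_of_notMem k hx).le c.2)
      simp [fiberMap_of_not k (fun h => hx h.1), hc]
  map_comp {x y z} f g := by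
    refine ModuleCat.hom_ext (LinearMap.ext fun c => Subtype.ext ?_)
    by_cases h : toExt x.1 ∈ I ∧ toExt z.1 ∈ I
    · have hy : toExt y.1 ∈ I := hI.out h.1 h.2 ⟨toExt_mono f.le, toExt_mono g.le⟩
      simp [fiberMap_coe_of_mem k h.1 h.2, fiberMap_coe_of_mem k hy h.2,
        fiberMap_coe_of_mem k h.1 hy]
    · by_cases hx : toExt x.1 ∈ I
      · have hz : toExt z.1 ∉ I := fun hz => h ⟨hx, hz⟩
        simp [fiberMap_of_not k h, fiberMap_of_not k (fun h' : toExt y.1 ∈ I ∧ _ => hz h'.2)]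
      · simp [fiberMap_of_not k h, fiberMap_of_not k (fun h' : _ ∧ toExt y.1 ∈ I => hx h'.1)]

/-- The rectangle module with interval `[u, v]`. -/
def rectangleModule (u v : EReal × EReal) : PersistenceModule k univ :=
  intervalModule k (Icc u v) ordConnected_Icc

end IntervalModule

/-- The bounding rectangle of `I`, the smallest rectangle of the extended plane containing `I`. -/
def boundingRectangle (I : Set (EReal × EReal)) : Set (EReal × EReal) := Icc (sInf I) (sSup I)

/-- The band of the rectangle `[u, v]`: the part of the plane between the diagonal lines (of slope
one) through its bottom-right corner `(v₁, u₂)` and its top-left corner `(u₁, v₂)`. -/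
def band (u v : EReal × EReal) : Set (ℝ × ℝ) :=
  {x | u.2 - v.1 ≤ ((x.2 - x.1 : ℝ) : EReal) ∧ ((x.2 - x.1 : ℝ) : EReal) ≤ v.2 - u.1}

instance band_diagonallyInvariant (u v : EReal × EReal) : DiagonallyInvariant (band u v) where
  add_mem x hx t := by
    have h : (x.2 + t) - (x.1 + t) = x.2 - x.1 := by ring
    simp only [band, mem_ofPred_eq, h]
    exact hx

end PersMod

end

/-! Let S be the set of points of the plane where `M` is non-zero, and T = T₁ × T₂ the corresponding
set for `R`, a product of closed real intervals.

Upper bound. If δ exceeds all three distances to zero, every internal map of `M` and `R` over 2δ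
vanishes, and zero morphisms interleave. If δ exceeds the distance to zero off the band and the
Hausdorff distance on it, use the maps that are the identity wherever source and target are
non-zero. Being δ-close gives most of the interleaving conditions by order-convexity alone. The two
remaining naturality conditions (`diag_mem_of_near`, `mem_of_near`) hold because a point of S
translated by -δ from the lower edge of T would be too far from T, and dually.

Lower bound. Let φ, ψ be a δ-interleaving. A non-zero internal map of `M` over 2δ factors through
`R`, so its diagonal meets T and lies in the band; this bounds the distance off the band. If all
internal maps over 2δ vanish, both distances to zero on the band are at most δ. Otherwise φ and ψ
are both non-zero, and the Hausdorff distance is at most δ. To see this, keep only the locus where a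
morphism is non-zero: naturality lets membership spread along comparable points (`IsTransfer`).
Spreading it along zigzags confined to the rectangle spanned by their endpoints
(`IsInterval.zigzagConnected`) yields both inclusions, `IsTransfer.exists_target_near` and
`IsTransfer.exists_source_near`. -/

namespace PersMod

/-! ### Diagonal translations and zigzags in the plane -/

/-- The translation of the plane by `(t, t)`. -/
def diag (t : ℝ) (x : ℝ × ℝ) : ℝ × ℝ := (x.1 + t, x.2 + t)

@[simp] theorem diag_fst (t : ℝ) (x : ℝ × ℝ) : (diag t x).1 = x.1 + t := rfl

@[simp] theorem diag_snd (t : ℝ) (x : ℝ × ℝ) : (diag t x).2 = x.2 + t := rfl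

theorem diag_diag (s t : ℝ) (x : ℝ × ℝ) : diag s (diag t x) = diag (t + s) x := by
  ext <;> simp [add_assoc]

@[simp] theorem diag_zero (x : ℝ × ℝ) : diag 0 x = x := by ext <;> simp

theorem diag_mono (t : ℝ) {x y : ℝ × ℝ} (h : x ≤ y) : diag t x ≤ diag t y :=
  ⟨by simpa using h.1, by simpa using h.2⟩

/-- Any two points `p`, `q` of `S` are joined by a zigzag of comparable points of `S` that stays in
the rectangle spanned by `p` and `q`. -/
def ZigzagConnected (S : Set (ℝ × ℝ)) : Prop :=
  ∀ p ∈ S, ∀ q ∈ S, Relation.ReflTransGen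
    (fun a b => a ∈ S ∧ (b ∈ S ∧ b ∈ Icc (p ⊓ q) (p ⊔ q)) ∧ (a ≤ b ∨ b ≤ a)) p q

theorem ZigzagConnected.swap {S : Set (ℝ × ℝ)} (h : ZigzagConnected S) :
    ZigzagConnected (Prod.swap ⁻¹' S) := by
  intro p hp q hq
  have := (h _ hp _ hq).lift (p := fun a b => a ∈ Prod.swap ⁻¹' S ∧
    (b ∈ Prod.swap ⁻¹' S ∧ b ∈ Icc (p ⊓ q) (p ⊔ q)) ∧ (a ≤ b ∨ b ≤ a)) Prod.swap ?_
  · simpa [Function.onFun] using this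
  · rintro a b ⟨ha, ⟨hb, hb1, hb2⟩, hab⟩
    refine ⟨by simpa using ha, ⟨by simpa using hb, ⟨hb1.2, hb1.1⟩, ⟨hb2.2, hb2.1⟩⟩, ?_⟩
    exact hab.imp Prod.swap_le_swap.2 Prod.swap_le_swap.2

theorem ZigzagConnected.neg {S : Set (ℝ × ℝ)} (h : ZigzagConnected S) :
    ZigzagConnected (Neg.neg ⁻¹' S) := by
  intro p hp q hq
  have := (h _ hp _ hq).lift (p := fun a b => a ∈ Neg.neg ⁻¹' S ∧
    (b ∈ Neg.neg ⁻¹' S ∧ b ∈ Icc (p ⊓ q) (p ⊔ q)) ∧ (a ≤ b ∨ b ≤ a)) (fun x => -x) ?_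
  · simpa [Function.onFun] using this
  · rintro a b ⟨ha, ⟨hb, hb1, hb2⟩, hab⟩
    refine ⟨by simpa using ha, ⟨by simpa using hb, ?_, ?_⟩, ?_⟩
    · simpa [neg_sup] using neg_le_neg hb2
    · simpa [neg_inf] using neg_le_neg hb1
    · exact hab.symm.imp neg_le_neg neg_le_neg

/-! ### Loci of non-zero morphisms -/

/-- The properties of the set `A` of points at which a morphism from an interval module with
underlying set `S` to the `δ`-shift of one with underlying set `T` is non-zero. -/
structure IsTransfer (S T : Set (ℝ × ℝ)) (δ : ℝ) (A : Set (ℝ × ℝ)) : Prop where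
  source : ∀ x ∈ A, x ∈ S
  target : ∀ x ∈ A, diag δ x ∈ T
  mem_iff : ∀ x y, x ≤ y → x ∈ S → diag δ y ∈ T → (x ∈ A ↔ y ∈ A)

theorem IsTransfer.swap {S T A : Set (ℝ × ℝ)} {δ : ℝ} (h : IsTransfer S T δ A) :
    IsTransfer (Prod.swap ⁻¹' S) (Prod.swap ⁻¹' T) δ (Prod.swap ⁻¹' A) where
  source _ hx := h.source _ hx
  target _ hx := h.target _ hx
  mem_iff _ _ hxy hx hy := h.mem_iff _ _ (Prod.swap_le_swap.2 hxy) hx hy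

/-- Duality: point reflection reverses the order, so source and target trade roles, and the locus is
re-indexed by the endpoint `diag δ x` of each arrow. -/
theorem IsTransfer.neg {S T A : Set (ℝ × ℝ)} {δ : ℝ} (h : IsTransfer T S δ A) :
    IsTransfer (Neg.neg ⁻¹' S) (Neg.neg ⁻¹' T) δ {x | -diag δ x ∈ A} where
  source x hx := by
    have := h.target _ hx
    have e : diag δ (-diag δ x) = -x := by ext <;> simp
    rwa [e] at this
  target x hx := h.source _ hx
  mem_iff x y hxy hx hy := by
    have e : diag δ (-diag δ x) = -x := by ext <;> simp
    exact (h.mem_iff (-diag δ y) (-diag δ x) (neg_le_neg (diag_mono δ hxy)) hy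
      (by rw [e]; exact hx)).symm

/-! ### Non-zero morphisms force proximity to a product -/

section Product

variable {S A : Set (ℝ × ℝ)} {T₁ T₂ : Set ℝ} {δ : ℝ}

/-- If T₁ lay strictly to the right of `x.1 + δ`, membership in `A` would spread from `p` to `x`,
although `diag δ x` would then miss the target. -/
theorem IsTransfer.exists_le_fst (hA : IsTransfer S (T₁ ×ˢ T₂) δ A) (hS : ZigzagConnected S)
    (h₁ : T₁.OrdConnected) (h₂ : T₂.OrdConnected) {p x : ℝ × ℝ} (hp : p ∈ A) (hx : x ∈ S)
    {t : ℝ} (ht : diag t x ∈ T₁ ×ˢ T₂) : ∃ r ∈ T₁, r ≤ x.1 + δ := by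
  by_contra! H
  have hpT := hA.target _ hp
  suffices hxA : x ∈ A from (H _ (hA.target _ hxA).1).false
  have hx1 : x.1 < p.1 := by simpa using H _ hpT.1
  have htδ : δ < t := by simpa using H _ ht.1
  rcases le_total x.2 p.2 with hx2 | hx2
  · exact (hA.mem_iff x p ⟨hx1.le, hx2⟩ hx hpT).2 hp
  -- Downward steps stay in `A` automatically. An upward step needs its end, moved by δ, to be in
  -- the target: the spanned rectangle bounds it by `p.1` on the right and by `x.2` above, and `x.2
  -- + δ` is below `x.2 + t`.
  · have key := hS p (hA.source _ hp) x hx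
    suffices ∀ w, Relation.ReflTransGen
        (fun c d => c ∈ S ∧ (d ∈ S ∧ d ∈ Icc (p ⊓ x) (p ⊔ x)) ∧ (c ≤ d ∨ d ≤ c)) p w →
        w ∈ A from this x key
    intro w hw
    induction hw with
    | refl => exact hp
    | @tail z w _ hzw hz =>
      obtain ⟨-, ⟨hw, hw1, hw2⟩, h | h⟩ := hzw
      · have hzT := hA.target _ hz
        refine (hA.mem_iff z w h (hA.source _ hz) ⟨?_, ?_⟩).1 hz
        · refine h₁.out hzT.1 hpT.1 ⟨?_, ?_⟩
          · simpa using h.1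
          · simpa using le_trans hw2.1 (max_le le_rfl hx1.le)
        · refine h₂.out hpT.2 ht.2 ⟨?_, ?_⟩
          · simpa using le_trans (le_min le_rfl hx2) hw1.2
          · have := le_trans hw2.2 (max_le hx2 le_rfl)
            simp only [diag_snd]
            linarith
      · exact (hA.mem_iff w z h hw (hA.target _ hz)).2 hz

theorem IsTransfer.exists_le_snd (hA : IsTransfer S (T₁ ×ˢ T₂) δ A) (hS : ZigzagConnected S)
    (h₁ : T₁.OrdConnected) (h₂ : T₂.OrdConnected) {p x : ℝ × ℝ} (hp : p ∈ A) (hx : x ∈ S)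
    {t : ℝ} (ht : diag t x ∈ T₁ ×ˢ T₂) : ∃ r ∈ T₂, r ≤ x.2 + δ := by
  have h := hA.swap
  rw [preimage_swap_prod] at h
  exact h.exists_le_fst hS.swap h₂ h₁ (p := p.swap) (x := x.swap) (t := t)
    (by simpa using hp) (by simpa using hx) ⟨ht.2, ht.1⟩

theorem IsTransfer.exists_ge (hA : IsTransfer (T₁ ×ˢ T₂) S δ A) (hS : ZigzagConnected S)
    (h₁ : T₁.OrdConnected) (h₂ : T₂.OrdConnected) {p x : ℝ × ℝ} (hp : p ∈ A) (hx : x ∈ S)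
    {t : ℝ} (ht : diag t x ∈ T₁ ×ˢ T₂) :
    (∃ r ∈ T₁, x.1 - δ ≤ r) ∧ ∃ r ∈ T₂, x.2 - δ ≤ r := by
  have h := hA.neg
  have e : Neg.neg ⁻¹' (T₁ ×ˢ T₂) = (Neg.neg ⁻¹' T₁) ×ˢ (Neg.neg ⁻¹' T₂) := rfl
  rw [e] at h
  have h₁' : (Neg.neg ⁻¹' T₁).OrdConnected :=
    ⟨fun a ha b hb c hc => h₁.out hb ha ⟨neg_le_neg hc.2, neg_le_neg hc.1⟩⟩
  have h₂' : (Neg.neg ⁻¹' T₂).OrdConnected :=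
    ⟨fun a ha b hb c hc => h₂.out hb ha ⟨neg_le_neg hc.2, neg_le_neg hc.1⟩⟩
  have hp' : diag (-δ) (-p) ∈ {x | -diag δ x ∈ A} := by
    have e : -diag δ (diag (-δ) (-p)) = p := by ext <;> simp
    rw [mem_ofPred_eq, e]; exact hp
  have hx' : -x ∈ Neg.neg ⁻¹' S := by simpa using hx
  have ht' : diag (-t) (-x) ∈ (Neg.neg ⁻¹' T₁) ×ˢ (Neg.neg ⁻¹' T₂) := by
    have e : -diag (-t) (-x) = diag t x := by ext <;> simp <;> ring
    rw [← e] at ht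
    exact ht
  obtain ⟨r, hr, hr'⟩ := h.exists_le_fst hS.neg h₁' h₂' hp' hx' ht'
  obtain ⟨s, hs, hs'⟩ := h.exists_le_snd hS.neg h₁' h₂' hp' hx' ht'
  simp only [Prod.fst_neg, Prod.snd_neg] at hr' hs'
  exact ⟨⟨-r, hr, by linarith⟩, -s, hs, by linarith⟩

theorem exists_mem_abs_sub_le {T : Set ℝ} (hT : T.OrdConnected) {x δ r s : ℝ} (hδ : 0 ≤ δ)
    (hr : r ∈ T) (hs : s ∈ T) (hrx : r ≤ x + δ) (hsx : x - δ ≤ s) : ∃ z ∈ T, |x - z| ≤ δ := by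
  by_cases h1 : x - δ ≤ r
  · exact ⟨r, hr, abs_le.2 ⟨by linarith, by linarith⟩⟩
  · exact ⟨x - δ, hT.out hr hs ⟨by linarith, hsx⟩, abs_le.2 ⟨by linarith, by linarith⟩⟩

/-- Comparable `a ≤ b` allow an explicit witness; otherwise a zigzag from `a` to `b` must cross the
vertical line at `x.1 - δ`, and the crossing point is the witness. -/
theorem exists_near_of_fst_le (hS : ZigzagConnected S) (hS' : S.OrdConnected)
    (h₁ : T₁.OrdConnected) (h₂ : T₂.OrdConnected) {x a b : ℝ × ℝ} (hδ : 0 ≤ δ)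
    (hx : x ∈ T₁ ×ˢ T₂) (ha : a ∈ S) (hb : b ∈ S) (haT : diag (-δ) a ∈ T₁ ×ˢ T₂)
    (hax : a ≤ diag δ x) (hxb : diag (-δ) x ≤ b) (hab : a.1 ≤ b.1) :
    ∃ y ∈ S, (∃ t, diag t y ∈ T₁ ×ˢ T₂) ∧ |x.1 - y.1| ≤ δ ∧ |x.2 - y.2| ≤ δ := by
  obtain ⟨hax1, hax2⟩ := hax
  obtain ⟨hxb1, hxb2⟩ := hxb
  simp only [diag_fst, diag_snd] at hax1 hax2 hxb1 hxb2
  rcases le_total a.2 b.2 with h | h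
  -- The least point above `a` that is not too far below `x`; moved by `-δ` it lies between `diag
  -- (-δ) a` and `x` in each coordinate.
  · refine ⟨a ⊔ diag (-δ) x, hS'.out ha hb ⟨le_sup_left, sup_le ⟨hab, h⟩ ⟨hxb1, hxb2⟩⟩,
      ⟨-δ, ?_, ?_⟩, ?_, ?_⟩
    · refine h₁.out haT.1 hx.1 ⟨by simp, ?_⟩
      have : max a.1 (x.1 + -δ) ≤ x.1 + δ := max_le hax1 (by linarith)
      simp only [diag_fst, Prod.fst_sup]
      linarith
    · refine h₂.out haT.2 hx.2 ⟨by simp, ?_⟩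
      have : max a.2 (x.2 + -δ) ≤ x.2 + δ := max_le hax2 (by linarith)
      simp only [diag_snd, Prod.snd_sup]
      linarith
    · have : max a.1 (x.1 + -δ) ≤ x.1 + δ := max_le hax1 (by linarith)
      have := le_max_right a.1 (x.1 + -δ)
      simp only [diag_fst, Prod.fst_sup, abs_le]
      constructor <;> linarith
    · have : max a.2 (x.2 + -δ) ≤ x.2 + δ := max_le hax2 (by linarith)
      have := le_max_right a.2 (x.2 + -δ)
      simp only [diag_snd, Prod.snd_sup, abs_le]
      constructor <;> linarith
  · by_contra! H
    have H' : ∀ y ∈ S, (∃ t, diag t y ∈ T₁ ×ˢ T₂) → |x.1 - y.1| ≤ δ → |x.2 - y.2| ≤ δ → False :=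
      fun y h1 h2 h3 h4 => (H y h1 h2 h3).not_ge h4
    suffices hb' : (b.1 < x.1 - δ ∧ b ∈ S) ∧ b.2 ∈ Icc b.2 a.2 by linarith [hb'.1.1]
    have ha1 : a.1 < x.1 - δ := by
      by_contra! h'
      exact H' a ha ⟨_, haT⟩ (abs_le.2 ⟨by linarith, by linarith⟩)
        (abs_le.2 ⟨by linarith, by linarith⟩)
    have key := hS a ha b hb
    suffices ∀ w, Relation.ReflTransGen
        (fun c d => c ∈ S ∧ (d ∈ S ∧ d ∈ Icc (a ⊓ b) (a ⊔ b)) ∧ (c ≤ d ∨ d ≤ c)) a w →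
        (w.1 < x.1 - δ ∧ w ∈ S) ∧ w.2 ∈ Icc b.2 a.2 from this b key
    intro w hw
    induction hw with
    | refl => exact ⟨⟨ha1, ha⟩, h, le_rfl⟩
    | @tail c d _ hcd hc =>
      obtain ⟨⟨hc1, hcS⟩, hc2, hc3⟩ := hc
      obtain ⟨-, ⟨hd, hd1, hd2⟩, hcd⟩ := hcd
      refine ⟨⟨?_, hd⟩, le_trans (le_min h le_rfl) hd1.2, le_trans hd2.2 (max_le le_rfl h)⟩
      by_contra! h'
      have hle : c ≤ d := hcd.resolve_right fun hdc => by linarith [hdc.1]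
      -- The crossing point lies between `c` and `d`, hence in `S`. Its height is within δ of `x.2`,
      -- since it is between `b.2` and `a.2`; sliding it diagonally to height `x.2` lands in the
      -- product.
      refine H' (x.1 - δ, c.2) (hS'.out hcS hd ⟨⟨hc1.le, le_rfl⟩, ⟨h', hle.2⟩⟩)
        ⟨x.2 - c.2, ?_, ?_⟩ ?_ ?_
      · have := haT.1
        simp only [diag_fst] at this
        refine h₁.out this hx.1 ⟨?_, ?_⟩ <;> simp only [diag_fst] <;> linarith
      · simpa using hx.2
      · simp [abs_of_nonneg hδ]
      · exact abs_le.2 ⟨by linarith, by linarith⟩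

theorem exists_near (hS : ZigzagConnected S) (hS' : S.OrdConnected)
    (h₁ : T₁.OrdConnected) (h₂ : T₂.OrdConnected) {x a b : ℝ × ℝ} (hδ : 0 ≤ δ)
    (hx : x ∈ T₁ ×ˢ T₂) (ha : a ∈ S) (hb : b ∈ S) (haT : diag (-δ) a ∈ T₁ ×ˢ T₂)
    (hax : a ≤ diag δ x) (hxb : diag (-δ) x ≤ b) :
    ∃ y ∈ S, (∃ t, diag t y ∈ T₁ ×ˢ T₂) ∧ |x.1 - y.1| ≤ δ ∧ |x.2 - y.2| ≤ δ := by
  rcases le_total a.1 b.1 with h1 | h1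
  · exact exists_near_of_fst_le hS hS' h₁ h₂ hδ hx ha hb haT hax hxb h1
  rcases le_total a.2 b.2 with h2 | h2
  · have hS'' : (Prod.swap ⁻¹' S).OrdConnected :=
      ⟨fun p hp q hq r hr => hS'.out hp hq
        ⟨Prod.swap_le_swap.2 hr.1, Prod.swap_le_swap.2 hr.2⟩⟩
    obtain ⟨y, hy, ⟨t, ht⟩, hy1, hy2⟩ := exists_near_of_fst_le (a := a.swap) (b := b.swap)
      (x := x.swap) hS.swap hS'' h₂ h₁ hδ ⟨hx.2, hx.1⟩ (by simpa using ha) (by simpa using hb)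
      ⟨haT.2, haT.1⟩ ⟨hax.2, hax.1⟩ ⟨hxb.2, hxb.1⟩ h2
    exact ⟨y.swap, hy, ⟨t, ht.2, ht.1⟩, hy2, hy1⟩
  · obtain ⟨hax1, hax2⟩ := hax
    obtain ⟨hxb1, hxb2⟩ := hxb
    simp only [diag_fst, diag_snd] at hax1 hax2 hxb1 hxb2
    exact ⟨a, ha, ⟨_, haT⟩, abs_le.2 ⟨by linarith, by linarith⟩,
      abs_le.2 ⟨by linarith, by linarith⟩⟩

/-- If there are non-zero morphisms from `S` to `T₁ × T₂` and back, then each point of `S` whose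
diagonal meets `T₁ × T₂` is `δ`-close to `T₁ × T₂`. -/
theorem IsTransfer.exists_target_near {B : Set (ℝ × ℝ)} (hA : IsTransfer S (T₁ ×ˢ T₂) δ A)
    (hB : IsTransfer (T₁ ×ˢ T₂) S δ B) (hS : ZigzagConnected S) (h₁ : T₁.OrdConnected)
    (h₂ : T₂.OrdConnected) (hδ : 0 ≤ δ) (hAne : A.Nonempty) (hBne : B.Nonempty) {x : ℝ × ℝ}
    (hx : x ∈ S) {t : ℝ} (ht : diag t x ∈ T₁ ×ˢ T₂) :
    ∃ y ∈ T₁ ×ˢ T₂, |x.1 - y.1| ≤ δ ∧ |x.2 - y.2| ≤ δ := by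
  obtain ⟨p, hp⟩ := hAne
  obtain ⟨q, hq⟩ := hBne
  obtain ⟨r₁, hr₁, hr₁'⟩ := hA.exists_le_fst hS h₁ h₂ hp hx ht
  obtain ⟨r₂, hr₂, hr₂'⟩ := hA.exists_le_snd hS h₁ h₂ hp hx ht
  obtain ⟨⟨s₁, hs₁, hs₁'⟩, s₂, hs₂, hs₂'⟩ := hB.exists_ge hS h₁ h₂ hq hx ht
  obtain ⟨z₁, hz₁, hz₁'⟩ := exists_mem_abs_sub_le h₁ hδ hr₁ hs₁ hr₁' hs₁'
  obtain ⟨z₂, hz₂, hz₂'⟩ := exists_mem_abs_sub_le h₂ hδ hr₂ hs₂ hr₂' hs₂'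
  exact ⟨(z₁, z₂), ⟨hz₁, hz₂⟩, hz₁', hz₂'⟩

/-- If there are non-zero morphisms from `S` to `T₁ × T₂` and back, then each point of `T₁ × T₂`
is `δ`-close to a point of `S` whose diagonal meets `T₁ × T₂`. -/
theorem IsTransfer.exists_source_near {B : Set (ℝ × ℝ)} (hA : IsTransfer S (T₁ ×ˢ T₂) δ A)
    (hB : IsTransfer (T₁ ×ˢ T₂) S δ B) (hS : ZigzagConnected S) (hS' : S.OrdConnected)
    (h₁ : T₁.OrdConnected) (h₂ : T₂.OrdConnected) (hδ : 0 ≤ δ) (hAne : A.Nonempty)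
    (hBne : B.Nonempty) {x : ℝ × ℝ} (hx : x ∈ T₁ ×ˢ T₂) :
    ∃ y ∈ S, (∃ t, diag t y ∈ T₁ ×ˢ T₂) ∧ |x.1 - y.1| ≤ δ ∧ |x.2 - y.2| ≤ δ := by
  obtain ⟨p, hp⟩ := hAne
  obtain ⟨q, hq⟩ := hBne
  have hpT := hA.target _ hp
  have hqT := hB.source _ hq
  have hinf : q ⊓ x ∈ T₁ ×ˢ T₂ := by
    constructor
    · rcases min_choice q.1 x.1 with h | h <;> rw [Prod.fst_inf, h]
      exacts [hqT.1, hx.1]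
    · rcases min_choice q.2 x.2 with h | h <;> rw [Prod.snd_inf, h]
      exacts [hqT.2, hx.2]
  have hsup : diag δ p ⊔ x ∈ T₁ ×ˢ T₂ := by
    constructor
    · rcases max_choice (diag δ p).1 x.1 with h | h <;> rw [Prod.fst_sup, h]
      exacts [hpT.1, hx.1]
    · rcases max_choice (diag δ p).2 x.2 with h | h <;> rw [Prod.snd_sup, h]
      exacts [hpT.2, hx.2]
  -- Within the product, `B` is closed downwards, and `A` moved by δ is closed upwards. This
  -- supplies points of `S` below `diag δ x` and above `diag (-δ) x`.
  have ha : q ⊓ x ∈ B := (hB.mem_iff _ q inf_le_left hinf (hB.target _ hq)).2 hq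
  have e : diag δ (diag (-δ) (diag δ p ⊔ x)) = diag δ p ⊔ x := by simp [diag_diag]
  have hb : diag (-δ) (diag δ p ⊔ x) ∈ A := by
    refine (hA.mem_iff p _ ?_ (hA.source _ hp) (by rwa [e])).1 hp
    have := diag_mono (-δ) (le_sup_left : diag δ p ≤ diag δ p ⊔ x)
    simpa [diag_diag] using this
  refine exists_near hS hS' h₁ h₂ hδ hx (hB.target _ ha) (hA.source _ hb) ?_
    (diag_mono _ inf_le_right) (diag_mono _ le_sup_right)
  simpa [diag_diag] using hinf

end Product

/-! ### Proximity to a closed product forces naturality -/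

section Closed

/-- Descending from `x` towards `y` inside `T`, one either reaches `y` or, by closedness, stops at
the minimum of `T`. -/
theorem exists_mem_Icc_eq_or_forall_le {T : Set ℝ} (hT : T.OrdConnected) (hc : IsClosed T)
    {x y : ℝ} (hx : x ∈ T) (hyx : y ≤ x) :
    ∃ c ∈ T, y ≤ c ∧ c ≤ x ∧ (c = y ∨ ∀ d ∈ T, c ≤ d) := by
  obtain ⟨c, ⟨hcT, hyc, hcx⟩, hmin⟩ :=
    (isCompact_Icc.inter_left hc : IsCompact (T ∩ Icc y x)).exists_isLeast ⟨x, hx, hyx, le_rfl⟩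
  refine ⟨c, hcT, hyc, hcx, or_iff_not_imp_left.2 fun hne d hd => ?_⟩
  by_contra! hdc
  have hlt : max d y < c := max_lt hdc (lt_of_le_of_ne hyc (Ne.symm hne))
  exact hlt.not_ge (hmin ⟨hT.out hd hcT ⟨le_max_left _ _, hlt.le⟩, le_max_right _ _,
    hlt.le.trans hcx⟩)

variable {S : Set (ℝ × ℝ)} {T₁ T₂ : Set ℝ} {δ ε : ℝ}

/-- Descend from `diag δ x` towards `diag δ y` in each coordinate. Stopping early at a minimum of
`T₁` or `T₂` is impossible: translated back by δ, the stopping point is in `S` and so within `ε < δ`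
of the product, which would put an element below that minimum. -/
theorem diag_mem_of_near (hS : S.OrdConnected) (h₁ : T₁.OrdConnected) (h₂ : T₂.OrdConnected)
    (hc₁ : IsClosed T₁) (hc₂ : IsClosed T₂) (hε : ε < δ)
    (hnear : ∀ w ∈ S, (∃ t, diag t w ∈ T₁ ×ˢ T₂) →
      ∃ z ∈ T₁ ×ˢ T₂, |w.1 - z.1| ≤ ε ∧ |w.2 - z.2| ≤ ε)
    {x y : ℝ × ℝ} (hyx : y ≤ x) (hy : y ∈ S) (hx : x ∈ S) (hxT : diag δ x ∈ T₁ ×ˢ T₂) :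
    diag δ y ∈ T₁ ×ˢ T₂ := by
  have hle := diag_mono δ hyx
  obtain ⟨c, hc, hyc, hcx, hc'⟩ := exists_mem_Icc_eq_or_forall_le h₁ hc₁ hxT.1 hle.1
  obtain ⟨d, hd, hyd, hdx, hd'⟩ := exists_mem_Icc_eq_or_forall_le h₂ hc₂ hxT.2 hle.2
  simp only [diag_fst, diag_snd] at *
  obtain ⟨z, hz, hz1, hz2⟩ := hnear (c - δ, d - δ)
    (hS.out hy hx ⟨⟨by simp; linarith, by simp; linarith⟩, ⟨by simp; linarith, by simp; linarith⟩⟩)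
    ⟨δ, by simpa using hc, by simpa using hd⟩
  rw [abs_le] at hz1 hz2
  have e1 : c = y.1 + δ := hc'.resolve_right fun h => by linarith [h _ hz.1]
  have e2 : d = y.2 + δ := hd'.resolve_right fun h => by linarith [h _ hz.2]
  exact ⟨by rwa [e1] at hc, by rwa [e2] at hd⟩

/-- The dual of `diag_mem_of_near` under point reflection, with maxima of the factors in place of
minima. -/
theorem mem_of_near (hS : S.OrdConnected) (h₁ : T₁.OrdConnected) (h₂ : T₂.OrdConnected)
    (hc₁ : IsClosed T₁) (hc₂ : IsClosed T₂) (hε : ε < δ)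
    (hnear : ∀ w ∈ S, (∃ t, diag t w ∈ T₁ ×ˢ T₂) →
      ∃ z ∈ T₁ ×ˢ T₂, |w.1 - z.1| ≤ ε ∧ |w.2 - z.2| ≤ ε)
    {x y : ℝ × ℝ} (hxy : x ≤ y) (hy : diag δ y ∈ S) (hx : diag δ x ∈ S) (hxT : x ∈ T₁ ×ˢ T₂) :
    y ∈ T₁ ×ˢ T₂ := by
  have hneg {α : Type} [AddCommGroup α] [PartialOrder α] [IsOrderedAddMonoid α] {T : Set α}
      (h : T.OrdConnected) : (Neg.neg ⁻¹' T).OrdConnected :=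
    ⟨fun a ha b hb c hc => h.out hb ha ⟨neg_le_neg hc.2, neg_le_neg hc.1⟩⟩
  have e (z : ℝ × ℝ) : -diag δ (-diag δ z) = z := by ext <;> simp
  have := diag_mem_of_near (hneg hS) (hneg h₁) (hneg h₂) (hc₁.preimage continuous_neg)
    (hc₂.preimage continuous_neg) hε ?_ (neg_le_neg (diag_mono δ hxy))
    (by simpa using hy) (by simpa using hx)
    (show -diag δ (-diag δ x) ∈ T₁ ×ˢ T₂ by rwa [e])
  · have h : -diag δ (-diag δ y) ∈ T₁ ×ˢ T₂ := this
    rwa [e] at h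
  · rintro w hw ⟨t, ht⟩
    have ht' : -diag t w ∈ T₁ ×ˢ T₂ := ht
    obtain ⟨z, hz, hz1, hz2⟩ := hnear (-w) hw ⟨-t, by
      have e' : diag (-t) (-w) = -diag t w := by ext <;> simp <;> ring
      rwa [e']⟩
    refine ⟨-z, by simpa using hz, ?_, ?_⟩
    · rw [← abs_neg]; convert hz1 using 2; simp; ring
    · rw [← abs_neg]; convert hz2 using 2; simp; ring

end Closed

/-! ### Intervals, rectangles and bands in the plane -/

theorem ordConnected_toExt_preimage {I : Set (EReal × EReal)} (hI : I.OrdConnected) :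
    (toExt ⁻¹' I).OrdConnected :=
  ⟨fun _ hp _ hq _ hr => hI.out hp hq ⟨toExt_mono hr.1, toExt_mono hr.2⟩⟩

/-- The nearest point of `[l, h]`. -/
noncomputable def clamp (l h : ℝ) (z : EReal) : ℝ := (max (l : EReal) (min z h)).toReal

theorem coe_clamp (l h : ℝ) (z : EReal) : (clamp l h z : EReal) = max (l : EReal) (min z h) :=
  EReal.coe_toReal (ne_of_lt (max_lt (EReal.coe_lt_top _) (min_lt_of_right_lt
    (EReal.coe_lt_top _)))) (ne_of_gt (lt_max_of_lt_left (EReal.bot_lt_coe _)))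

theorem clamp_coe {l h r : ℝ} (hr : r ∈ Icc l h) : clamp l h r = r := by
  rw [← EReal.coe_eq_coe_iff, coe_clamp, min_eq_left (by exact_mod_cast hr.2),
    max_eq_right (by exact_mod_cast hr.1)]

theorem clamp_mono (l h : ℝ) {z w : EReal} (hzw : z ≤ w) : clamp l h z ≤ clamp l h w := by
  rw [← EReal.coe_le_coe_iff, coe_clamp, coe_clamp]
  gcongr

theorem clamp_mem {l h : ℝ} (hlh : l ≤ h) (z : EReal) : clamp l h z ∈ Icc l h := by
  constructor <;> rw [← EReal.coe_le_coe_iff, coe_clamp]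
  · exact le_max_left _ _
  · exact max_le (by exact_mod_cast hlh) (min_le_right _ _)

/-- The nearest point of the rectangle `[l, h]`. -/
noncomputable def clampProd (l h : ℝ × ℝ) (z : EReal × EReal) : ℝ × ℝ :=
  (clamp l.1 h.1 z.1, clamp l.2 h.2 z.2)

/-- The projection is squeezed between points of `I`: where clamping lowers a coordinate, one of the
two corners lies below the result, and otherwise `z` itself does; symmetrically above. -/
theorem toExt_clampProd_mem_of_corners {I : Set (EReal × EReal)} (hI : I.OrdConnected)
    {l h : ℝ × ℝ} (hlh : l ≤ h) (h1 : toExt (l.1, h.2) ∈ I) (h2 : toExt (h.1, l.2) ∈ I)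
    {z : EReal × EReal} (hz : z ∈ I) : toExt (clampProd l h z) ∈ I := by
  have m1 := clamp_mem hlh.1 z.1
  have m2 := clamp_mem hlh.2 z.2
  have lower : ∃ w ∈ I, w ≤ toExt (clampProd l h z) := by
    by_cases c1 : (h.1 : EReal) ≤ z.1
    · refine ⟨_, h2, toExt_mono ⟨?_, m2.1⟩⟩
      rw [← EReal.coe_le_coe_iff]
      simp [clampProd, coe_clamp, c1]
    by_cases c2 : (h.2 : EReal) ≤ z.2
    · refine ⟨_, h1, toExt_mono ⟨m1.1, ?_⟩⟩
      rw [← EReal.coe_le_coe_iff]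
      simp [clampProd, coe_clamp, c2]
    push Not at c1 c2
    exact ⟨z, hz, by simp [toExt, clampProd, coe_clamp, c1.le],
      by simp [toExt, clampProd, coe_clamp, c2.le]⟩
  have upper : ∃ w ∈ I, toExt (clampProd l h z) ≤ w := by
    by_cases c1 : z.1 ≤ (l.1 : EReal)
    · refine ⟨_, h1, toExt_mono ⟨?_, m2.2⟩⟩
      rw [← EReal.coe_le_coe_iff]
      simp [clampProd, coe_clamp, c1]
    by_cases c2 : z.2 ≤ (l.2 : EReal)
    · refine ⟨_, h2, toExt_mono ⟨m1.2, ?_⟩⟩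
      rw [← EReal.coe_le_coe_iff]
      simp [clampProd, coe_clamp, c2]
    push Not at c1 c2
    exact ⟨z, hz, by simp [toExt, clampProd, coe_clamp, c1.le],
      by simp [toExt, clampProd, coe_clamp, c2.le]⟩
  obtain ⟨a, ha, ha'⟩ := lower
  obtain ⟨b, hb, hb'⟩ := upper
  exact hI.out ha hb ⟨ha', hb'⟩

theorem toExt_clampProd_mem {I : Set (EReal × EReal)} (hI : I.OrdConnected)
    {p q : ℝ × ℝ} (hp : toExt p ∈ I) (hq : toExt q ∈ I)
    {z : EReal × EReal} (hz : z ∈ I) : toExt (clampProd (p ⊓ q) (p ⊔ q) z) ∈ I := by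
  have m1 := clamp_mem (inf_le_sup : (p ⊓ q).1 ≤ (p ⊔ q).1) z.1
  have m2 := clamp_mem (inf_le_sup : (p ⊓ q).2 ≤ (p ⊔ q).2) z.2
  have lo : p ⊓ q ≤ clampProd (p ⊓ q) (p ⊔ q) z := ⟨m1.1, m2.1⟩
  have hi : clampProd (p ⊓ q) (p ⊔ q) z ≤ p ⊔ q := ⟨m1.2, m2.2⟩
  have inf_le : p ⊓ q ≤ p ⊔ q := inf_le_sup
  rcases le_total p.1 q.1 with h1 | h1 <;> rcases le_total p.2 q.2 with h2 | h2
  · rw [inf_eq_left.2 (show p ≤ q from ⟨h1, h2⟩), sup_eq_right.2 (show p ≤ q from ⟨h1, h2⟩)]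
      at lo hi ⊢
    exact hI.out hp hq ⟨toExt_mono lo, toExt_mono hi⟩
  · refine toExt_clampProd_mem_of_corners hI inf_le ?_ ?_ hz
    · simpa [h1, h2] using hp
    · simpa [h1, h2] using hq
  · refine toExt_clampProd_mem_of_corners hI inf_le ?_ ?_ hz
    · simpa [h1, h2] using hq
    · simpa [h1, h2] using hp
  · rw [inf_eq_right.2 (show q ≤ p from ⟨h1, h2⟩), sup_eq_left.2 (show q ≤ p from ⟨h1, h2⟩)]
      at lo hi ⊢
    exact hI.out hq hp ⟨toExt_mono lo, toExt_mono hi⟩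

/-- Nearest-point projection onto the rectangle spanned by `p` and `q` is monotone, fixes `p` and
`q`, and preserves `I`. It thus confines a zigzag of `I` to this rectangle and also removes its
points at infinity. -/
theorem IsInterval.zigzagConnected {I : Set (EReal × EReal)} (hI : IsInterval I) :
    ZigzagConnected (toExt ⁻¹' I) := by
  intro p hp q hq
  have inf_le : p ⊓ q ≤ p ⊔ q := inf_le_sup
  have := (hI.connected _ hp _ hq).lift (p := fun a b => a ∈ toExt ⁻¹' I ∧
    (b ∈ toExt ⁻¹' I ∧ b ∈ Icc (p ⊓ q) (p ⊔ q)) ∧ (a ≤ b ∨ b ≤ a))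
    (clampProd (p ⊓ q) (p ⊔ q)) ?_
  · have hcl (x : ℝ × ℝ) (hx : x ∈ Icc (p ⊓ q) (p ⊔ q)) :
        clampProd (p ⊓ q) (p ⊔ q) (toExt x) = x :=
      Prod.ext (clamp_coe ⟨hx.1.1, hx.2.1⟩) (clamp_coe ⟨hx.1.2, hx.2.2⟩)
    rw [Function.onFun, hcl p ⟨inf_le_left, le_sup_left⟩, hcl q ⟨inf_le_right, le_sup_right⟩]
      at this
    exact this
  · rintro a b ⟨ha, hb, hab⟩
    have m1 := clamp_mem inf_le.1 b.1
    have m2 := clamp_mem inf_le.2 b.2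
    refine ⟨toExt_clampProd_mem hI.convex hp hq ha, ⟨toExt_clampProd_mem hI.convex hp hq hb,
      ⟨m1.1, m2.1⟩, ⟨m1.2, m2.2⟩⟩, hab.imp ?_ ?_⟩ <;>
    exact fun h => ⟨clamp_mono _ _ h.1, clamp_mono _ _ h.2⟩

theorem toExt_preimage_Icc (u v : EReal × EReal) :
    toExt ⁻¹' Icc u v =
      ((↑) ⁻¹' Icc u.1 v.1 : Set ℝ) ×ˢ ((↑) ⁻¹' Icc u.2 v.2 : Set ℝ) := by
  ext x
  exact ⟨fun h => ⟨⟨h.1.1, h.2.1⟩, h.1.2, h.2.2⟩, fun h => ⟨⟨h.1.1, h.2.1⟩, h.1.2, h.2.2⟩⟩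

theorem ordConnected_coe_preimage_Icc (a b : EReal) :
    ((↑) ⁻¹' Icc a b : Set ℝ).OrdConnected :=
  ⟨fun _ hp _ hq _ hr => ordConnected_Icc.out hp hq
    ⟨EReal.coe_le_coe_iff.2 hr.1, EReal.coe_le_coe_iff.2 hr.2⟩⟩

theorem isClosed_coe_preimage_Icc (a b : EReal) : IsClosed ((↑) ⁻¹' Icc a b : Set ℝ) :=
  isClosed_Icc.preimage continuous_coe_real_ereal

theorem toExt_preimage_Icc_subset_band (u v : EReal × EReal) :
    toExt ⁻¹' Icc u v ⊆ band u v := by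
  intro x hx
  have h1 := EReal.sub_le_sub hx.1.2 hx.2.1
  have h2 := EReal.sub_le_sub hx.2.2 hx.1.1
  exact ⟨by simpa [toExt] using h1, by simpa [toExt] using h2⟩

theorem exists_mem_Icc_add_mem_Icc {a b c d : EReal} {x y s t : ℝ}
    (h : c - b ≤ ((y - x : ℝ) : EReal)) (hst : s ≤ t)
    (hs : ((x + s : ℝ) : EReal) ∈ Icc a b) (ht : ((y + t : ℝ) : EReal) ∈ Icc c d) :
    ∃ r : ℝ, ((x + r : ℝ) : EReal) ∈ Icc a b ∧ ((y + r : ℝ) : EReal) ∈ Icc c d := by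
  have below {r : ℝ} (hr : s ≤ r) : a ≤ ((x + r : ℝ) : EReal) :=
    hs.1.trans (EReal.coe_le_coe_iff.2 (by linarith))
  have above {r : ℝ} (hr : r ≤ t) : ((y + r : ℝ) : EReal) ≤ d :=
    le_trans (EReal.coe_le_coe_iff.2 (by linarith)) ht.2
  induction c with
  | bot => exact ⟨s, hs, bot_le, above hst⟩
  | top => exact absurd ht.1 (not_le_of_gt (EReal.coe_lt_top _))
  | coe c =>
    have htc : c ≤ y + t := by exact_mod_cast ht.1
    -- The smallest shift meeting both lower bounds; the hypothesis `h` says exactly that it does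
    -- not overshoot `b`.
    refine ⟨max s (c - y), ⟨below (le_max_left _ _), ?_⟩, ?_, above (max_le hst (by linarith))⟩
    · rcases max_choice s (c - y) with h' | h' <;> rw [h']
      · exact hs.2
      · induction b with
        | bot => exact absurd hs.2 (not_le_of_gt (EReal.bot_lt_coe _))
        | top => exact le_top
        | coe b =>
          rw [← EReal.coe_sub, EReal.coe_le_coe_iff] at h
          rw [EReal.coe_le_coe_iff]
          linarith
    · rw [EReal.coe_le_coe_iff]
      linarith [le_max_right s (c - y)]

/-- The band of a rectangle with a real point consists of the diagonals that meet the rectangle. -/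
theorem exists_diag_mem_of_mem_band {u v : EReal × EReal} (hne : (toExt ⁻¹' Icc u v).Nonempty)
    {x : ℝ × ℝ} (hx : x ∈ band u v) : ∃ t, diag t x ∈ toExt ⁻¹' Icc u v := by
  obtain ⟨q, hq⟩ := hne
  have e1 : x.1 + (q.1 - x.1) = q.1 := by ring
  have e2 : x.2 + (q.2 - x.2) = q.2 := by ring
  have hq1 : ((x.1 + (q.1 - x.1) : ℝ) : EReal) ∈ Icc u.1 v.1 := by
    rw [e1]; exact ⟨hq.1.1, hq.2.1⟩
  have hq2 : ((x.2 + (q.2 - x.2) : ℝ) : EReal) ∈ Icc u.2 v.2 := by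
    rw [e2]; exact ⟨hq.1.2, hq.2.2⟩
  rw [toExt_preimage_Icc]
  rcases le_total (q.1 - x.1) (q.2 - x.2) with h | h
  · obtain ⟨r, h1, h2⟩ := exists_mem_Icc_add_mem_Icc hx.1 h hq1 hq2
    exact ⟨r, h1, h2⟩
  · have hx2 : u.1 - v.2 ≤ ((x.1 - x.2 : ℝ) : EReal) := by
      have := EReal.neg_le_neg_iff.2 hx.2
      rw [EReal.neg_sub (Or.inl (ne_bot_of_le_ne_bot (EReal.coe_ne_bot _) hq.2.2))
        (Or.inr (ne_top_of_le_ne_top (EReal.coe_ne_top _) hq.1.1)), add_comm, ← EReal.coe_neg,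
        neg_sub] at this
      exact this
    obtain ⟨r, h1, h2⟩ := exists_mem_Icc_add_mem_Icc hx2 h hq2 hq1
    exact ⟨r, h2, h1⟩

/-! ### Interleavings and trivial modules -/

section Interleavings

universe w

variable {k : Type w} [Field k]

theorem isZero_zeroModule_obj {D : Set (ℝ × ℝ)} (x : D) :
    Limits.IsZero ((zeroModule k D).obj x) :=
  ModuleCat.isZero_of_subsingleton (ModuleCat.of k PUnit.{w + 1})

variable {D : Set (ℝ × ℝ)} [DiagonallyInvariant D] {M N : PersistenceModule k D} {δ : ℝ≥0}

theorem interleaved_of_map_eq_zero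
    (hM : ∀ x : D, M.map (homOfLE ((le_shift δ x).trans (le_shift δ _))) = 0)
    (hN : ∀ x : D, N.map (homOfLE ((le_shift δ x).trans (le_shift δ _))) = 0) :
    Interleaved M N δ :=
  ⟨fun _ => 0, fun _ => 0, fun x => by simp [hM x], fun x => by simp [hN x],
    fun _ _ _ => by simp, fun _ _ _ => by simp⟩

theorem interleaved_zero_iff : Interleaved M (zeroModule k D) δ ↔
    ∀ x : D, M.map (homOfLE ((le_shift δ x).trans (le_shift δ _))) = 0 := by
  refine ⟨fun ⟨φ, ψ, h, _⟩ x => ?_, fun h => interleaved_of_map_eq_zero h fun x =>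
    (isZero_zeroModule_obj x).eq_zero_of_src _⟩
  rw [← h x, (isZero_zeroModule_obj (shift δ x)).eq_zero_of_src (ψ (shift δ x)),
    Limits.comp_zero]

theorem dI_le_of_interleaved (h : Interleaved M N δ) : dI M N ≤ δ :=
  iInf₂_le δ h

theorem exists_interleaved_of_dI_lt (h : dI M N < δ) : ∃ ε < δ, Interleaved M N ε := by
  simp only [dI, iInf_lt_iff] at h
  obtain ⟨ε, hε, hlt⟩ := h
  exact ⟨ε, by exact_mod_cast hlt, hε⟩

end Interleavings

/-! ### Morphisms between interval modules and their loci -/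

section IntervalModules

universe w

variable {k : Type w} [Field k]

theorem coe_fiberMap (I : Set (EReal × EReal)) (x y : ℝ × ℝ)
    [Decidable (toExt x ∈ I ∧ toExt y ∈ I)] (c : fiber k I x) :
    (fiberMap k I x y c : k) = if toExt x ∈ I ∧ toExt y ∈ I then (c : k) else 0 := by
  split_ifs with h
  · exact fiberMap_coe_of_mem k h.1 h.2 c
  · simp [fiberMap_of_not k h]

theorem fiber_coe_eq_zero {I : Set (EReal × EReal)} {x : ℝ × ℝ} (h : toExt x ∉ I)
    (c : fiber k I x) : (c : k) = 0 :=
  (Submodule.mem_bot k).1 ((fiber_of_notMem k h).le c.2)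

theorem mem_fiber {I : Set (EReal × EReal)} {x : ℝ × ℝ} (h : toExt x ∈ I) (c : k) :
    c ∈ fiber k I x := by
  rw [fiber_of_mem k h]; trivial

open Classical in
/-- The map between fibers of two interval modules that is the identity where both are non-zero. -/
noncomputable def fiberHom (I J : Set (EReal × EReal)) (x y : ℝ × ℝ) :
    fiber k I x →ₗ[k] fiber k J y :=
  if h : toExt x ∈ I ∧ toExt y ∈ J then
    Submodule.inclusion ((fiber_of_mem k h.2).symm ▸ le_top)
  else 0

theorem coe_fiberHom (I J : Set (EReal × EReal)) (x y : ℝ × ℝ)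
    [Decidable (toExt x ∈ I ∧ toExt y ∈ J)] (c : fiber k I x) :
    (fiberHom I J x y c : k) = if toExt x ∈ I ∧ toExt y ∈ J then (c : k) else 0 := by
  rw [fiberHom]
  split_ifs <;> rfl

variable {I J : Set (EReal × EReal)} {hI : I.OrdConnected} {hJ : J.OrdConnected} {δ : ℝ≥0}

theorem intervalModule_map_eq_zero_iff {x y : (univ : Set (ℝ × ℝ))} (f : x ⟶ y) :
    (intervalModule k I hI).map f = 0 ↔ ¬ (toExt x.1 ∈ I ∧ toExt y.1 ∈ I) := by
  refine ⟨fun h hxy => ?_, fun h => ?_⟩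
  · have h1 := congrArg (fun g => g.hom (⟨1, mem_fiber hxy.1 1⟩ : fiber k I x.1)) h
    have h2 := congrArg (fun c : fiber k I y.1 => (c : k)) h1
    have h3 := fiberMap_coe_of_mem k hxy.1 hxy.2 ⟨1, mem_fiber hxy.1 1⟩
    exact one_ne_zero (h3.symm.trans h2)
  · change ModuleCat.ofHom (fiberMap k I x.1 y.1) = 0
    rw [fiberMap_of_not k h]
    rfl

theorem interleaved_restrict_zero_iff {D : Set (ℝ × ℝ)} [DiagonallyInvariant D] :
    Interleaved (restrict (intervalModule k I hI) D) (zeroModule k D) δ ↔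
      ∀ x ∈ D, toExt x ∈ I → toExt (diag δ (diag δ x)) ∉ I := by
  rw [interleaved_zero_iff]
  constructor
  · intro h x hx h1 h2
    exact (intervalModule_map_eq_zero_iff (hI := hI) (k := k) (x := ⟨x, mem_univ _⟩)
      (homOfLE ((le_shift δ _).trans (le_shift δ _)))).1 (h ⟨x, hx⟩) ⟨h1, h2⟩
  · intro h x
    exact (intervalModule_map_eq_zero_iff (hI := hI) (k := k) (x := ⟨x.1, mem_univ _⟩)
      (homOfLE ((le_shift δ _).trans (le_shift δ _)))).2 fun h' => h x.1 x.2 h'.1 h'.2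

theorem support_restrict_intervalModule (D : Set (ℝ × ℝ)) :
    support (restrict (intervalModule k I hI) D) = toExt ⁻¹' I ∩ D := by
  ext x
  constructor
  · rintro ⟨hx, hne⟩
    refine ⟨by_contra fun h => ?_, hx⟩
    obtain ⟨a, b, hab⟩ := hne
    exact hab (Subtype.ext (a1 := (a : fiber k I x)) (a2 := (b : fiber k I x))
      ((fiber_coe_eq_zero h _).trans (fiber_coe_eq_zero h _).symm))
  · rintro ⟨hx, hxD⟩
    refine ⟨hxD, (⟨1, mem_fiber hx 1⟩ : fiber k I x), (0 : fiber k I x), fun h => ?_⟩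
    exact one_ne_zero (congrArg (fun c : fiber k I x => (c : k)) h)

-- The first two hypotheses are naturality of the identity-where-possible maps, the last two say
-- that their composites are the internal maps over 2δ.
open Classical in
theorem interleaved_intervalModule
    (h1 : ∀ x y, x ≤ y → toExt x ∈ I → toExt (diag δ y) ∈ J →
      (toExt (diag δ x) ∈ J ↔ toExt y ∈ I))
    (h2 : ∀ x y, x ≤ y → toExt x ∈ J → toExt (diag δ y) ∈ I →
      (toExt (diag δ x) ∈ I ↔ toExt y ∈ J))
    (h3 : ∀ x, toExt x ∈ I → toExt (diag δ (diag δ x)) ∈ I → toExt (diag δ x) ∈ J)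
    (h4 : ∀ x, toExt x ∈ J → toExt (diag δ (diag δ x)) ∈ J → toExt (diag δ x) ∈ I) :
    Interleaved (intervalModule k I hI) (intervalModule k J hJ) δ := by
  have hcomp {I J : Set (EReal × EReal)}
      (h3 : ∀ x, toExt x ∈ I → toExt (diag δ (diag δ x)) ∈ I → toExt (diag δ x) ∈ J)
      (x : ℝ × ℝ) (c : fiber k I x) :
      fiberHom J I (diag δ x) (diag δ (diag δ x)) (fiberHom I J x (diag δ x) c) =
        fiberMap k I x (diag δ (diag δ x)) c := by
    refine Subtype.ext ?_
    rw [coe_fiberHom, coe_fiberHom, coe_fiberMap]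
    rw [← ite_and]
    have := h3 x
    exact if_congr (by tauto) rfl rfl
  have hnat {I J : Set (EReal × EReal)}
      (h1 : ∀ x y, x ≤ y → toExt x ∈ I → toExt (diag δ y) ∈ J →
        (toExt (diag δ x) ∈ J ↔ toExt y ∈ I))
      (x y : ℝ × ℝ) (hxy : x ≤ y) (c : fiber k I x) :
      fiberHom I J y (diag δ y) (fiberMap k I x y c) =
        fiberMap k J (diag δ x) (diag δ y) (fiberHom I J x (diag δ x) c) := by
    refine Subtype.ext ?_
    rw [coe_fiberHom, coe_fiberMap, coe_fiberMap, coe_fiberHom]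
    rw [← ite_and, ← ite_and]
    have := h1 x y hxy
    exact if_congr (by tauto) rfl rfl
  refine ⟨fun x => ModuleCat.ofHom (fiberHom I J x.1 (diag δ x.1)),
    fun x => ModuleCat.ofHom (fiberHom J I x.1 (diag δ x.1)), ?_, ?_, ?_, ?_⟩
  · exact fun x => ModuleCat.hom_ext (LinearMap.ext (hcomp h3 x.1))
  · exact fun x => ModuleCat.hom_ext (LinearMap.ext (hcomp h4 x.1))
  · exact fun x y h => ModuleCat.hom_ext (LinearMap.ext (hnat h1 x.1 y.1 h))
  · exact fun x y h => ModuleCat.hom_ext (LinearMap.ext (hnat h2 x.1 y.1 h))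

/-- The locus where a family of linear maps between fibers is non-zero. -/
def homLocus (I J : Set (EReal × EReal)) (δ : ℝ)
    (φ : ∀ x : ℝ × ℝ, fiber k I x →ₗ[k] fiber k J (diag δ x)) : Set (ℝ × ℝ) :=
  {x | φ x ≠ 0}

theorem hom_eq_zero_of_notMem_source {x : ℝ × ℝ} (hx : toExt x ∉ I) {V : Type*}
    [AddCommGroup V] [Module k V] (f : fiber k I x →ₗ[k] V) : f = 0 := by
  refine LinearMap.ext fun c => ?_
  rw [show c = 0 from Subtype.ext (fiber_coe_eq_zero hx c), map_zero, map_zero]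

theorem hom_eq_zero_of_notMem_target {x : ℝ × ℝ} (hx : toExt x ∉ I) {V : Type*}
    [AddCommGroup V] [Module k V] (f : V →ₗ[k] fiber k I x) : f = 0 :=
  LinearMap.ext fun c => Subtype.ext (fiber_coe_eq_zero hx (f c))

theorem isTransfer_homLocus {ε : ℝ} (φ : ∀ x : ℝ × ℝ, fiber k I x →ₗ[k] fiber k J (diag ε x))
    (hφ : ∀ x y, x ≤ y → φ y ∘ₗ fiberMap k I x y = fiberMap k J (diag ε x) (diag ε y) ∘ₗ φ x) :
    IsTransfer (toExt ⁻¹' I) (toExt ⁻¹' J) ε (homLocus I J ε φ) where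
  source x hx := by_contra fun h => hx (hom_eq_zero_of_notMem_source h _)
  target x hx := by_contra fun h => hx (hom_eq_zero_of_notMem_target h _)
  mem_iff x y hxy hx hy := by
    refine not_congr ⟨fun h => ?_, fun h => ?_⟩
    · by_cases hyI : toExt y ∈ I
      · refine LinearMap.ext fun c => ?_
        have h' := LinearMap.congr_fun (hφ x y hxy) ⟨c, mem_fiber hx _⟩
        have e : fiberMap k I x y ⟨c, mem_fiber hx _⟩ = c :=
          Subtype.ext (fiberMap_coe_of_mem k hx hyI _)
        rw [LinearMap.comp_apply, e, h, LinearMap.comp_zero] at h'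
        exact h'
      · exact hom_eq_zero_of_notMem_source hyI _
    · by_cases hxJ : toExt (diag ε x) ∈ J
      · refine LinearMap.ext fun c => Subtype.ext ?_
        have h' := LinearMap.congr_fun (hφ x y hxy) c
        rw [h, LinearMap.zero_comp] at h'
        have := congrArg (fun d : fiber k J (diag ε y) => (d : k)) h'
        rw [LinearMap.comp_apply] at this
        simp only [fiberMap_coe_of_mem k hxJ hy] at this
        exact this.symm
      · exact hom_eq_zero_of_notMem_target hxJ _

/-- A non-zero internal map over 2δ is a composite of components of the two morphisms, so both of
these components are non-zero. -/
theorem Interleaved.exists_isTransfer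
    (h : Interleaved (intervalModule k I hI) (intervalModule k J hJ) δ) :
    ∃ A B, IsTransfer (toExt ⁻¹' I) (toExt ⁻¹' J) δ A ∧
      IsTransfer (toExt ⁻¹' J) (toExt ⁻¹' I) δ B ∧
      (∀ x, toExt x ∈ I → toExt (diag δ (diag δ x)) ∈ I → x ∈ A ∧ diag δ x ∈ B) ∧
      (∀ x, toExt x ∈ J → toExt (diag δ (diag δ x)) ∈ J → x ∈ B ∧ diag δ x ∈ A) := by
  obtain ⟨φ, ψ, h1, h2, h3, h4⟩ := h
  refine ⟨homLocus I J δ fun x => (φ ⟨x, mem_univ x⟩).hom,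
    homLocus J I δ fun x => (ψ ⟨x, mem_univ x⟩).hom, isTransfer_homLocus _ fun x y hxy => ?_,
    isTransfer_homLocus _ fun x y hxy => ?_, fun x hx hx' => ?_, fun x hx hx' => ?_⟩
  · exact congrArg ModuleCat.Hom.hom (h3 ⟨x, mem_univ x⟩ ⟨y, mem_univ y⟩ hxy)
  · exact congrArg ModuleCat.Hom.hom (h4 ⟨x, mem_univ x⟩ ⟨y, mem_univ y⟩ hxy)
  · have key := h1 ⟨x, mem_univ x⟩
    have hne := mt (intervalModule_map_eq_zero_iff (k := k) (hI := hI)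
      (homOfLE ((le_shift δ ⟨x, mem_univ x⟩).trans (le_shift δ _)))).1 (not_not.2 ⟨hx, hx'⟩)
    constructor <;> intro h0 <;> refine hne (key.symm.trans ?_)
    · rw [show φ ⟨x, mem_univ x⟩ = 0 from ModuleCat.hom_ext h0, Limits.zero_comp]
    · rw [show ψ (shift δ ⟨x, mem_univ x⟩) = 0 from ModuleCat.hom_ext h0, Limits.comp_zero]
  · have key := h2 ⟨x, mem_univ x⟩
    have hne := mt (intervalModule_map_eq_zero_iff (k := k) (hI := hJ)
      (homOfLE ((le_shift δ ⟨x, mem_univ x⟩).trans (le_shift δ _)))).1 (not_not.2 ⟨hx, hx'⟩)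
    constructor <;> intro h0 <;> refine hne (key.symm.trans ?_)
    · rw [show ψ ⟨x, mem_univ x⟩ = 0 from ModuleCat.hom_ext h0, Limits.zero_comp]
    · rw [show φ (shift δ ⟨x, mem_univ x⟩) = 0 from ModuleCat.hom_ext h0, Limits.comp_zero]

end IntervalModules

theorem edist_le_coe_iff {x y : ℝ × ℝ} {r : ℝ≥0} :
    edist x y ≤ r ↔ |x.1 - y.1| ≤ r ∧ |x.2 - y.2| ≤ r := by
  rw [edist_le_coe, ← NNReal.coe_le_coe, coe_nndist, Prod.dist_eq, max_le_iff, Real.dist_eq,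
    Real.dist_eq]

section Distances

universe w

variable {k : Type w} [Field k] {D : Set (ℝ × ℝ)} [DiagonallyInvariant D]

theorem dI_le_of_forall_interleaved {M N : PersistenceModule k D} {a : ℝ≥0∞}
    (h : ∀ δ : ℝ≥0, a < δ → Interleaved M N δ) : dI M N ≤ a := by
  refine le_of_forall_gt fun c hc => ?_
  obtain ⟨δ, h1, h2⟩ := ENNReal.lt_iff_exists_nnreal_btwn.1 hc
  exact (dI_le_of_interleaved (h δ h1)).trans_lt h2

theorem diag_diag_notMem_of_dI_zero_lt {I : Set (EReal × EReal)} {hI : I.OrdConnected} {δ : ℝ≥0}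
    (h : dI (restrict (intervalModule k I hI) D) (zeroModule k D) < δ) {x : ℝ × ℝ} (hx : x ∈ D)
    (hxI : toExt x ∈ I) : toExt (diag δ (diag δ x)) ∉ I := by
  intro hx'
  obtain ⟨η, hη, hint⟩ := exists_interleaved_of_dI_lt h
  have hηδ : (η : ℝ) ≤ δ := by exact_mod_cast hη.le
  have hη0 := η.2
  refine interleaved_restrict_zero_iff.1 hint x hx hxI
    ((ordConnected_toExt_preimage hI).out hxI hx' ⟨?_, ?_⟩)
  · exact ⟨by simp; linarith, by simp; linarith⟩
  · exact ⟨by simp; linarith, by simp; linarith⟩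

theorem dI_restrict_zero_eq_zero {I : Set (EReal × EReal)} {hI : I.OrdConnected}
    (h : toExt ⁻¹' I ∩ D = ∅) :
    dI (restrict (intervalModule k I hI) D) (zeroModule k D) = 0 := by
  refine le_antisymm (dI_le_of_interleaved (δ := 0) (interleaved_restrict_zero_iff.2
    fun x hx hxI => ?_)) zero_le
  have : x ∈ toExt ⁻¹' I ∩ D := ⟨hxI, hx⟩
  simp [h] at this

end Distances

/-! ### Interleavings of an interval module with a rectangle module -/

section Rectangle

universe w

theorem mem_band_of_diag_mem {u v : EReal × EReal} {x : ℝ × ℝ} {t : ℝ}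
    (hx : diag t x ∈ toExt ⁻¹' Icc u v) : x ∈ band u v := by
  have := (band_diagonallyInvariant u v).add_mem _ (toExt_preimage_Icc_subset_band u v hx) (-t)
  simpa using this

variable {k : Type w} [Field k] {I : Set (EReal × EReal)} {u v : EReal × EReal} {δ : ℝ≥0}

theorem hausdorffEDist_le_of_interleaved (hI : IsInterval I)
    (h : Interleaved (intervalModule k I hI.convex) (rectangleModule k u v) δ)
    (hne : ∃ x, toExt x ∈ I ∧ toExt (diag δ (diag δ x)) ∈ I ∨
      toExt x ∈ Icc u v ∧ toExt (diag δ (diag δ x)) ∈ Icc u v) :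
    (toExt ⁻¹' I ∩ band u v).Nonempty ∧ (toExt ⁻¹' Icc u v).Nonempty ∧
      Metric.hausdorffEDist (toExt ⁻¹' I ∩ band u v) (toExt ⁻¹' Icc u v) ≤ δ := by
  obtain ⟨A, B, hA, hB, hAB, hBA⟩ := h.exists_isTransfer
  have hAB' : A.Nonempty ∧ B.Nonempty := by
    obtain ⟨x, hx | hx⟩ := hne
    · exact ⟨⟨_, (hAB x hx.1 hx.2).1⟩, ⟨_, (hAB x hx.1 hx.2).2⟩⟩
    · exact ⟨⟨_, (hBA x hx.1 hx.2).2⟩, ⟨_, (hBA x hx.1 hx.2).1⟩⟩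
  obtain ⟨hAne, hBne⟩ := hAB'
  have hT : (toExt ⁻¹' Icc u v).Nonempty := hBne.mono hB.source
  obtain ⟨p, hp⟩ := hAne
  refine ⟨⟨p, hA.source p hp, mem_band_of_diag_mem (hA.target p hp)⟩, hT, ?_⟩
  have h₁ := ordConnected_coe_preimage_Icc u.1 v.1
  have h₂ := ordConnected_coe_preimage_Icc u.2 v.2
  have hS := hI.zigzagConnected
  refine Metric.hausdorffEDist_le_of_mem_edist (fun x hx => ?_) fun x hx => ?_
  · obtain ⟨t, ht⟩ := exists_diag_mem_of_mem_band hT hx.2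
    rw [toExt_preimage_Icc] at hA hB ht
    obtain ⟨y, hy, hxy⟩ :=
      hA.exists_target_near hB hS h₁ h₂ δ.2 ⟨p, hp⟩ hBne hx.1 ht
    exact ⟨y, by rwa [toExt_preimage_Icc], edist_le_coe_iff.2 hxy⟩
  · rw [toExt_preimage_Icc] at hA hB hx
    obtain ⟨y, hy, ⟨t, ht⟩, hxy⟩ := hA.exists_source_near hB hS
      (ordConnected_toExt_preimage hI.convex) h₁ h₂ δ.2 ⟨p, hp⟩ hBne hx
    rw [← toExt_preimage_Icc] at ht
    exact ⟨y, ⟨hy, mem_band_of_diag_mem ht⟩, edist_le_coe_iff.2 hxy⟩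

theorem interleaved_of_hausdorffEDist_lt (hI : I.OrdConnected)
    (h0 : dI (restrict (intervalModule k I hI) (band u v)ᶜ) (zeroModule k (band u v)ᶜ) < δ)
    (hH : Metric.hausdorffEDist (toExt ⁻¹' I ∩ band u v) (toExt ⁻¹' Icc u v) < δ) :
    Interleaved (intervalModule k I hI) (rectangleModule k u v) δ := by
  -- The strict margin `ε < δ` is what rules out stopping at an extremal point in `diag_mem_of_near`
  -- and `mem_of_near`.
  obtain ⟨ε, hHε, hε⟩ := ENNReal.lt_iff_exists_nnreal_btwn.1 hH
  have hεδ : (ε : ℝ) < δ := by exact_mod_cast hε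
  have nearT : ∀ w ∈ toExt ⁻¹' I, w ∈ band u v →
      ∃ z ∈ toExt ⁻¹' Icc u v, |w.1 - z.1| ≤ ε ∧ |w.2 - z.2| ≤ ε := fun w hw hwb => by
    obtain ⟨z, hz, hwz⟩ := Metric.exists_edist_lt_of_hausdorffEDist_lt 
      (show w ∈ toExt ⁻¹' I ∩ band u v from ⟨hw, hwb⟩) hHε
    exact ⟨z, hz, edist_le_coe_iff.1 hwz.le⟩
  have nearS : ∀ w ∈ toExt ⁻¹' Icc u v,
      ∃ z ∈ toExt ⁻¹' I, |w.1 - z.1| ≤ ε ∧ |w.2 - z.2| ≤ ε := fun w hw => by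
    rw [Metric.hausdorffEDist_comm] at hHε
    obtain ⟨z, hz, hwz⟩ := Metric.exists_edist_lt_of_hausdorffEDist_lt hw hHε
    exact ⟨z, hz.1, edist_le_coe_iff.1 hwz.le⟩
  have hS := ordConnected_toExt_preimage hI
  have hT := ordConnected_toExt_preimage (ordConnected_Icc (a := u) (b := v))
  have h₁ := ordConnected_coe_preimage_Icc u.1 v.1
  have h₂ := ordConnected_coe_preimage_Icc u.2 v.2
  have hc₁ := isClosed_coe_preimage_Icc u.1 v.1
  have hc₂ := isClosed_coe_preimage_Icc u.2 v.2
  have nearT' : ∀ w ∈ toExt ⁻¹' I, (∃ t, diag t w ∈ toExt ⁻¹' Icc u v) →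
      ∃ z ∈ toExt ⁻¹' Icc u v, |w.1 - z.1| ≤ ε ∧ |w.2 - z.2| ≤ ε :=
    fun w hw ⟨t, ht⟩ => nearT w hw (mem_band_of_diag_mem ht)
  refine interleaved_intervalModule (fun x y hxy hx hy => ⟨fun hx' => ?_, fun hy' => ?_⟩)
    (fun x y hxy hx hy => ⟨fun hx' => ?_, fun hy' => ?_⟩) (fun x hx hx' => ?_) fun x hx hx' => ?_
  · obtain ⟨z, hz, hz1, hz2⟩ := nearS _ hy
    rw [abs_le, diag_fst] at hz1
    rw [abs_le, diag_snd] at hz2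
    exact hS.out hx hz ⟨hxy, by linarith, by linarith⟩
  · have := diag_mem_of_near (x := y) (y := x) hS h₁ h₂ hc₁ hc₂ hεδ
      (by rwa [← toExt_preimage_Icc]) hxy hx hy' (by rwa [← toExt_preimage_Icc])
    rwa [← toExt_preimage_Icc] at this
  · have := mem_of_near (x := x) (y := y) hS h₁ h₂ hc₁ hc₂ hεδ
      (by rwa [← toExt_preimage_Icc]) hxy hy hx' (by rwa [← toExt_preimage_Icc])
    rwa [← toExt_preimage_Icc] at this
  · obtain ⟨z, hz, hz1, hz2⟩ := nearS _ hx
    rw [abs_le] at hz1 hz2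
    exact hS.out hz hy ⟨⟨by simp; linarith, by simp; linarith⟩, diag_mono _ hxy⟩
  -- Off the band there is no nearby rectangle point to use, but `h0` excludes internal maps of this
  -- length there.
  · have hxb : x ∈ band u v := by
      by_contra hxb
      exact diag_diag_notMem_of_dI_zero_lt h0 hxb hx hx'
    have hxb' : diag δ (diag δ x) ∈ band u v :=
      (band_diagonallyInvariant u v).add_mem _
        ((band_diagonallyInvariant u v).add_mem _ hxb δ) δ
    obtain ⟨z, hz, hz1, hz2⟩ := nearT _ hx hxb
    obtain ⟨w, hw, hw1, hw2⟩ := nearT _ hx' hxb'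
    simp only [abs_le, diag_fst, diag_snd] at hz1 hz2 hw1 hw2
    exact hT.out hz hw ⟨⟨by simp; linarith, by simp; linarith⟩,
      ⟨by simp; linarith, by simp; linarith⟩⟩
  · obtain ⟨z, hz, hz1, hz2⟩ := nearS _ hx
    obtain ⟨w, hw, hw1, hw2⟩ := nearS _ hx'
    simp only [abs_le, diag_fst, diag_snd] at hz1 hz2 hw1 hw2
    exact hS.out hz hw ⟨⟨by simp; linarith, by simp; linarith⟩,
      ⟨by simp; linarith, by simp; linarith⟩⟩

end Rectangle

end PersMod

open PersMod in
theorem proposition3p6 {k : Type*} [Field k]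
    (I : Set (EReal × EReal)) (hI : IsInterval I) (hclosed : IsClosed I)
    (u v : EReal × EReal) (huv : u ≤ v) (hR : Set.Icc u v ⊆ boundingRectangle I)
    (M R : PersistenceModule k Set.univ)
    (hM : M = intervalModule k I hI.convex) (hRmod : R = rectangleModule k u v) :
    dI M R =
      max (dI (restrict M (band u v)ᶜ) (zeroModule k (band u v)ᶜ))
        (min
          (max (dI (restrict M (band u v)) (zeroModule k (band u v)))
            (dI (restrict R (band u v)) (zeroModule k (band u v))))
          (dH (restrict M (band u v)) (restrict R (band u v)))) := by
  subst hM hRmod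
  have hsM := support_restrict_intervalModule (k := k) (hI := hI.convex) (band u v)
  have hsR := support_restrict_intervalModule (k := k)
    (hI := Set.ordConnected_Icc (a := u) (b := v)) (band u v)
  rw [Set.inter_eq_left.2 (toExt_preimage_Icc_subset_band u v)] at hsR
  change support (restrict (rectangleModule k u v) (band u v)) = _ at hsR
  have hzR {δ : NNReal} : Interleaved (restrict (rectangleModule k u v) (band u v)) _ δ ↔ _ :=
    interleaved_restrict_zero_iff (hI := Set.ordConnected_Icc (a := u) (b := v))
  set a := dI (restrict (intervalModule k I hI.convex) (band u v)ᶜ) (zeroModule k (band u v)ᶜ)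
  set b := dI (restrict (intervalModule k I hI.convex) (band u v)) (zeroModule k (band u v))
    with hb
  set c := dI (restrict (rectangleModule k u v) (band u v)) (zeroModule k (band u v)) with hc
  have trivial_bound : dI (intervalModule k I hI.convex) (rectangleModule k u v) ≤
      max a (max b c) := by
    refine dI_le_of_forall_interleaved fun δ hδ => ?_
    rw [max_lt_iff, max_lt_iff] at hδ
    refine interleaved_of_map_eq_zero
      (fun x => (intervalModule_map_eq_zero_iff (hI := hI.convex) _).2 fun h => ?_)
      (fun x => (intervalModule_map_eq_zero_iff (hI := Set.ordConnected_Icc) _).2 fun h => ?_)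
    · by_cases hx : x.1 ∈ band u v
      · exact diag_diag_notMem_of_dI_zero_lt hδ.2.1 hx h.1 h.2
      · exact diag_diag_notMem_of_dI_zero_lt hδ.1 hx h.1 h.2
    · exact diag_diag_notMem_of_dI_zero_lt hδ.2.2 (toExt_preimage_Icc_subset_band u v h.1) h.1 h.2
  refine le_antisymm ?_ (max_le (le_iInf₂ fun δ hδ => ?_) (le_iInf₂ fun δ hδ => ?_))
  · rw [max_min_distrib_left]
    refine le_min trivial_bound ?_
    unfold dH
    rw [hsM, hsR]
    split_ifs with h1 h2
    -- Under the convention for a zero module, the Hausdorff term degenerates to `b` (here) or `c`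
    -- (next case) and the other one is zero, so zero morphisms suffice.
    · have hc0 : c = 0 := dI_restrict_zero_eq_zero (by rw [h1, Set.empty_inter])
      simpa [hc0] using trivial_bound
    · have hb0 : b = 0 := dI_restrict_zero_eq_zero h2
      simpa [hb0] using trivial_bound
    · refine dI_le_of_forall_interleaved fun δ hδ => ?_
      rw [max_lt_iff] at hδ
      exact interleaved_of_hausdorffEDist_lt hI.convex hδ.1 hδ.2
  · obtain ⟨A, B, hA, -, hAB, -⟩ := hδ.exists_isTransfer
    exact dI_le_of_interleaved (interleaved_restrict_zero_iff.2 fun x hx hxI hx' =>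
      hx (mem_band_of_diag_mem (hA.target x (hAB x hxI hx').1)))
  -- Some internal map over 2δ survives: both morphisms are non-zero and the Hausdorff term is
  -- bounded. None survives: the distances to zero are bounded.
  · by_cases hne : ∃ x, toExt x ∈ I ∧ toExt (diag δ (diag δ x)) ∈ I ∨
        toExt x ∈ Set.Icc u v ∧ toExt (diag δ (diag δ x)) ∈ Set.Icc u v
    · obtain ⟨h1, h2, h3⟩ := hausdorffEDist_le_of_interleaved hI hδ hne
      refine (min_le_right _ _).trans ?_
      rwa [dH, hsM, hsR, if_neg h2.ne_empty, if_neg h1.ne_empty]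
    · push Not at hne
      exact (min_le_left _ _).trans (max_le
        (dI_le_of_interleaved (interleaved_restrict_zero_iff.2 fun x _ h => (hne x).1 h))
        (dI_le_of_interleaved (hzR.2 fun x _ h => (hne x).2 h)))
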